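/- Let $-\infty<a<b<\infty$, let $\mathcal J=(a,b)$, $L_1=L_1(\mathcal J,\mathbb C)$, $L_2=L_2(\mathcal J,\mathbb C)$, and let $p,Q:\mathcal J\to\mathbb C$ be functions with $p(t)\neq 0$ for almost every $t$ and $$\frac1p,\ \frac Qp,\ \frac{Q^2}p\in L_1 .$$ For $y$ absolutely continuous on $[a,b]$ put $D^{[0]}y=y$, $D^{[1]}y=py'-Qy$ and, if $D^{[1]}y$ is (a.e. equal to a function) absolutely continuous on $[a,b]$, $D^{[2]}y=(D^{[1]}y)'+\frac Qp D^{[1]}y+\frac{Q^2}p y$. (The expression $l[y]=-D^{[2]}y$ is the regularization of the formal expression $-(py')'+qy$ with $q=Q'$.) Define operators on the Hilbert space $L_2$ as follows. The maximal operator is $L_{\max}y=-D^{[2]}y$ with domain $$\operatorname{Dom}(L_{\max})=\{y\in L_2:\ y,\,D^{[1]}y\in AC([a,b],\mathbb C),\ D^{[2]}y\in L_2\},$$ and the minimal operator $L_{\min}$ is the restriction of $L_{\max}$ to $$\operatorname{Dom}(L_{\min})=\{y\in \operatorname{Dom}(L_{\max}):\ D^{[k]}y(a)=D^{[k]}y(b)=0,\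 k=0,1\}.$$ Let $L^+_{\max}$ and $L^+_{\min}$ be the operators defined in the same way with $p,Q$ replaced by the complex conjugates $\overline p,\overline Q$ (they correspond to the formally adjoint expression $-(\overline p y')'+\overline q y$). Then $L_{\min}$, $L^+_{\min}$, $L_{\max}$ and $L^+_{\max}$ are closed and densely defined on $L_2$, and $$L_{\min}^*=L^+_{\max},\qquad L_{\max}^*=L^+_{\min}.$$ If moreover $p$ and $Q$ are real-valued (almost everywhere), then $L_{\min}=L^+_{\min}$, this operator is symmetric with deficiency index $(2,2)$, that is, $\dim\ker(L_{\min}^*-i)=\dim\ker(L_{\min}^*+i)=2$, and $$L_{\min}^*=L_{\max},\qquad L_{\max}^*=L_{\min}.$$ -/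

import Mathlib

open MeasureTheory Set
open scoped ComplexConjugate

noncomputable section

namespace SturmLiouville

/-- Lebesgue measure on the interval `(a, b)`. -/
abbrev μ (a b : ℝ) : Measure ℝ := volume.restrict (Ioo a b)

/-- The complex Hilbert space `L₂((a, b), ℂ)`. -/
abbrev L2 (a b : ℝ) : Type := Lp ℂ 2 (μ a b)

/-- The expression `p y' - Q y` (meaningful almost everywhere when `y` is absolutely continuous). -/
def quasiDeriv₁ (p Q : ℝ → ℂ) (y : ℝ → ℂ) (t : ℝ) : ℂ :=
  p t * deriv y t - Q t * y t

/-- The expression `u' + (Q / p) u + (Q² / p) y`; with `u = D^[1] y` this is `D^[2] y`. -/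
def quasiDeriv₂ (p Q : ℝ → ℂ) (y u : ℝ → ℂ) (t : ℝ) : ℂ :=
  deriv u t + Q t / p t * u t + Q t ^ 2 / p t * y t

/-- `y` is an absolutely continuous representative on `[a, b]` of `f ∈ L₂`, its quasi-derivative
`D^[1] y = p y' - Q y` agrees almost everywhere with the function `u`, absolutely continuous on
`[a, b]`, and `D^[2] y` belongs to `L₂`.  When `a < b`, the values of `y` and `u` on `[a, b]` are
determined by `f`. -/
structure IsRep (p Q : ℝ → ℂ) (a b : ℝ) (f : L2 a b) (y u : ℝ → ℂ) : Prop where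
  ae_eq : (f : ℝ → ℂ) =ᵐ[μ a b] y
  ac : AbsolutelyContinuousOnInterval y a b
  quasi_ae_eq : u =ᵐ[μ a b] quasiDeriv₁ p Q y
  quasi_ac : AbsolutelyContinuousOnInterval u a b
  memLp : MemLp (quasiDeriv₂ p Q y u) 2 (μ a b)

variable {p Q : ℝ → ℂ} {a b : ℝ}

lemma ae_differentiableAt {y : ℝ → ℂ} (hy : AbsolutelyContinuousOnInterval y a b) :
    ∀ᵐ t ∂(μ a b), DifferentiableAt ℝ y t := by
  rw [ae_restrict_iff' measurableSet_Ioo]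
  filter_upwards [hy.boundedVariationOn.ae_differentiableAt_of_mem_uIcc] with t ht hmem
  exact ht (Icc_subset_uIcc (Ioo_subset_Icc_self hmem))

lemma eqOn_of_ae_eq {y z : ℝ → ℂ} (hy : AbsolutelyContinuousOnInterval y a b)
    (hz : AbsolutelyContinuousOnInterval z a b) (h : y =ᵐ[μ a b] z) : EqOn y z (Ioo a b) :=
  Measure.eqOn_open_of_ae_eq h isOpen_Ioo
    (hy.continuousOn.mono (Ioo_subset_Icc_self.trans Icc_subset_uIcc))
    (hz.continuousOn.mono (Ioo_subset_Icc_self.trans Icc_subset_uIcc))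

lemma deriv_ae_eq {y z : ℝ → ℂ} (h : EqOn y z (Ioo a b)) :
    deriv y =ᵐ[μ a b] deriv z := by
  filter_upwards [ae_restrict_mem measurableSet_Ioo] with t ht
  exact Filter.EventuallyEq.deriv_eq (h.eventuallyEq_of_mem (isOpen_Ioo.mem_nhds ht))

lemma IsRep.quasiDeriv₂_ae_eq {f : L2 a b} {y u z v : ℝ → ℂ}
    (h : IsRep p Q a b f y u) (h' : IsRep p Q a b f z v) :
    quasiDeriv₂ p Q y u =ᵐ[μ a b] quasiDeriv₂ p Q z v := by
  have hyz : EqOn y z (Ioo a b) := eqOn_of_ae_eq h.ac h'.ac (h.ae_eq.symm.trans h'.ae_eq)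
  have hd := deriv_ae_eq hyz
  have huv : EqOn u v (Ioo a b) := by
    refine eqOn_of_ae_eq h.quasi_ac h'.quasi_ac ?_
    filter_upwards [h.quasi_ae_eq, h'.quasi_ae_eq, hd, ae_restrict_mem measurableSet_Ioo]
      with t h1 h2 h3 h4
    rw [h1, h2, quasiDeriv₁, quasiDeriv₁, h3, hyz h4]
  filter_upwards [deriv_ae_eq huv, ae_restrict_mem measurableSet_Ioo] with t h1 h2
  rw [quasiDeriv₂, quasiDeriv₂, h1, huv h2, hyz h2]

lemma quasiDeriv₂_add_ae_eq {y u z v : ℝ → ℂ} (hu : AbsolutelyContinuousOnInterval u a b)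
    (hv : AbsolutelyContinuousOnInterval v a b) :
    quasiDeriv₂ p Q (y + z) (u + v) =ᵐ[μ a b] quasiDeriv₂ p Q y u + quasiDeriv₂ p Q z v := by
  filter_upwards [ae_differentiableAt hu, ae_differentiableAt hv] with t h1 h2
  simp only [quasiDeriv₂, Pi.add_apply, deriv_add h1 h2]
  ring

lemma quasiDeriv₂_smul_ae_eq {y u : ℝ → ℂ} (c : ℂ) :
    quasiDeriv₂ p Q (c • y) (c • u) = c • quasiDeriv₂ p Q y u := by
  funext t
  simp only [quasiDeriv₂, Pi.smul_apply, smul_eq_mul, deriv_const_smul_field]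
  ring

lemma IsRep.add {f g : L2 a b} {y u z v : ℝ → ℂ}
    (h : IsRep p Q a b f y u) (h' : IsRep p Q a b g z v) :
    IsRep p Q a b (f + g) (y + z) (u + v) where
  ae_eq := (Lp.coeFn_add f g).trans (h.ae_eq.add h'.ae_eq)
  ac := h.ac.add h'.ac
  quasi_ae_eq := by
    filter_upwards [h.quasi_ae_eq, h'.quasi_ae_eq, ae_differentiableAt h.ac,
      ae_differentiableAt h'.ac] with t h1 h2 h3 h4
    simp only [Pi.add_apply, h1, h2, quasiDeriv₁, deriv_add h3 h4]
    ring
  quasi_ac := h.quasi_ac.add h'.quasi_ac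
  memLp := (h.memLp.add h'.memLp).ae_eq (quasiDeriv₂_add_ae_eq h.quasi_ac h'.quasi_ac).symm

lemma IsRep.smul {f : L2 a b} {y u : ℝ → ℂ} (c : ℂ) (h : IsRep p Q a b f y u) :
    IsRep p Q a b (c • f) (c • y) (c • u) where
  ae_eq := (Lp.coeFn_smul c f).trans (h.ae_eq.const_smul c)
  ac := h.ac.const_smul c
  quasi_ae_eq := by
    filter_upwards [h.quasi_ae_eq] with t h1
    simp only [Pi.smul_apply, smul_eq_mul, h1, quasiDeriv₁, deriv_const_smul_field]
    ring
  quasi_ac := h.quasi_ac.const_smul c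
  memLp := by
    rw [quasiDeriv₂_smul_ae_eq]
    exact h.memLp.const_smul c

lemma IsRep.zero : IsRep p Q a b 0 0 0 where
  ae_eq := Lp.coeFn_zero _ _ _
  ac := (LipschitzWith.const (0 : ℂ)).lipschitzOnWith.absolutelyContinuousOnInterval
  quasi_ae_eq := by
    refine Filter.Eventually.of_forall fun t => ?_
    simp [quasiDeriv₁]
  quasi_ac := (LipschitzWith.const (0 : ℂ)).lipschitzOnWith.absolutelyContinuousOnInterval
  memLp := by
    have : quasiDeriv₂ p Q 0 0 = 0 := by
      funext t
      simp [quasiDeriv₂]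
    rw [this]
    exact MemLp.zero

variable (p Q a b)

/-- `Dom(L_max)`: all `y ∈ L₂` such that `y, D^[1] y ∈ AC[a, b]` and `D^[2] y ∈ L₂`. -/
def maxDomain : Submodule ℂ (L2 a b) where
  carrier := {f | ∃ y u, IsRep p Q a b f y u}
  add_mem' := by
    rintro f g ⟨y, u, h⟩ ⟨z, v, h'⟩
    exact ⟨_, _, h.add h'⟩
  zero_mem' := ⟨0, 0, IsRep.zero⟩
  smul_mem' := by
    rintro c f ⟨y, u, h⟩
    exact ⟨_, _, h.smul c⟩

/-- The elements of `Dom(L_max)` such that `D^[k] y(a) = D^[k] y(b) = 0` for `k = 0, 1`. -/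
def minDomain : Submodule ℂ (L2 a b) where
  carrier := {f | ∃ y u, IsRep p Q a b f y u ∧ y a = 0 ∧ u a = 0 ∧ y b = 0 ∧ u b = 0}
  add_mem' := by
    rintro f g ⟨y, u, h, h1, h2, h3, h4⟩ ⟨z, v, h', h1', h2', h3', h4'⟩
    exact ⟨_, _, h.add h', by simp [h1, h1'], by simp [h2, h2'], by simp [h3, h3'],
      by simp [h4, h4']⟩
  zero_mem' := ⟨0, 0, IsRep.zero, rfl, rfl, rfl, rfl⟩
  smul_mem' := by
    rintro c f ⟨y, u, h, h1, h2, h3, h4⟩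
    exact ⟨_, _, h.smul c, by simp [h1], by simp [h2], by simp [h3], by simp [h4]⟩

variable {p Q a b}

lemma IsRep.toLp_eq {f : L2 a b} {y u z v : ℝ → ℂ}
    (h : IsRep p Q a b f y u) (h' : IsRep p Q a b f z v) :
    -h.memLp.toLp (quasiDeriv₂ p Q y u) = -h'.memLp.toLp (quasiDeriv₂ p Q z v) := by
  rw [MemLp.toLp_congr h.memLp h'.memLp (h.quasiDeriv₂_ae_eq h')]

variable (p Q a b)

/-- The maximal operator `L_max : y ↦ l[y] = -D^[2] y` on `Dom(L_max)`.  The value does not depend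
on the chosen representatives, see `maxOp_apply`. -/
def maxOp : L2 a b →ₗ.[ℂ] L2 a b where
  domain := maxDomain p Q a b
  toFun :=
    { toFun := fun f => -f.2.choose_spec.choose_spec.memLp.toLp
      map_add' := fun f g => by
        have hf := f.2.choose_spec.choose_spec
        have hg := g.2.choose_spec.choose_spec
        rw [(f + g).2.choose_spec.choose_spec.toLp_eq (hf.add hg),
          MemLp.toLp_congr (hf.add hg).memLp (hf.memLp.add hg.memLp)
            (quasiDeriv₂_add_ae_eq hf.quasi_ac hg.quasi_ac), MemLp.toLp_add, neg_add]
      map_smul' := fun c f => by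
        have hf := f.2.choose_spec.choose_spec
        rw [(c • f).2.choose_spec.choose_spec.toLp_eq (hf.smul c),
          MemLp.toLp_congr (hf.smul c).memLp (hf.memLp.const_smul c)
            (Filter.EventuallyEq.of_eq (quasiDeriv₂_smul_ae_eq c)), MemLp.toLp_const_smul,
          RingHom.id_apply, smul_neg] }

/-- The minimal operator `L_min`: the restriction of `L_max` to the functions with
`D^[k] y(a) = D^[k] y(b) = 0`, `k = 0, 1`. -/
def minOp : L2 a b →ₗ.[ℂ] L2 a b :=
  (maxOp p Q a b).domRestrict (minDomain p Q a b)

/-- The maximal operator `L_max⁺` of the formally adjoint expression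
`l⁺(y) = -(p̄ y')' + q̄ y`, `q̄ = (Q̄)'`. -/
def maxOpPlus : L2 a b →ₗ.[ℂ] L2 a b :=
  maxOp (fun t => conj (p t)) (fun t => conj (Q t)) a b

/-- The minimal operator `L_min⁺` of the formally adjoint expression. -/
def minOpPlus : L2 a b →ₗ.[ℂ] L2 a b :=
  minOp (fun t => conj (p t)) (fun t => conj (Q t)) a b

variable {p Q a b}

/-- `L_max` maps the class of `y` to the class of `-D^[2] y`, for any representatives. -/
lemma maxOp_apply (f : (maxOp p Q a b).domain) {y u : ℝ → ℂ}
    (h : IsRep p Q a b (f : L2 a b) y u) :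
    maxOp p Q a b f = -h.memLp.toLp (quasiDeriv₂ p Q y u) :=
  (f.2.choose_spec.choose_spec).toLp_eq h

lemma minOp_domain : (minOp p Q a b).domain = minDomain p Q a b :=
  inf_eq_left.2 fun _ ⟨y, u, h, _⟩ => ⟨y, u, h⟩

end SturmLiouville

section Operators

variable {H : Type*} [NormedAddCommGroup H] [InnerProductSpace ℂ H]

/-- A symmetric operator: densely defined with `⟪T x, y⟫ = ⟪x, T y⟫` on its domain. -/
def LinearPMap.IsSymmetricOp (T : H →ₗ.[ℂ] H) : Prop :=
  Dense (T.domain : Set H) ∧ T.IsFormalAdjoint T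

/-- The eigenspace `ker (T - z)` of an unbounded operator, as a subspace of `H`. -/
def LinearPMap.eigenspaceAt (T : H →ₗ.[ℂ] H) (z : ℂ) : Submodule ℂ H where
  carrier := {x | ∃ h : x ∈ T.domain, T ⟨x, h⟩ = z • x}
  add_mem' := by
    rintro x y ⟨hx, hx'⟩ ⟨hy, hy'⟩
    refine ⟨T.domain.add_mem hx hy, ?_⟩
    rw [smul_add, ← hx', ← hy', ← T.map_add]
    rfl
  zero_mem' := ⟨T.domain.zero_mem, by rw [smul_zero]; exact T.map_zero⟩
  smul_mem' := by
    rintro c x ⟨hx, hx'⟩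
    refine ⟨T.domain.smul_mem c hx, ?_⟩
    rw [smul_comm, ← hx', ← T.map_smul]
    rfl

/-- The deficiency index `(dim ker (T* - i), dim ker (T* + i))` of a densely defined symmetric
operator, with values in `ℕ ∪ {∞}`. -/
def LinearPMap.deficiencyIndex [CompleteSpace H] (T : H →ₗ.[ℂ] H) : ℕ∞ × ℕ∞ :=
  (Cardinal.toENat (Module.rank ℂ (T.adjoint.eigenspaceAt Complex.I)),
    Cardinal.toENat (Module.rank ℂ (T.adjoint.eigenspaceAt (-Complex.I))))

end Operators

end

/-! Everything reduces to the first-order system `y' = (Q/p) y + (1/p) u`, `u' = D^[2] y - (Q/p) u -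
(Q²/p) y`, whose coefficients are exactly the functions assumed integrable. Hence initial value
problems at `a` are uniquely solvable (`exists_absolutelyContinuous_solution`,
`eqOn_zero_of_linear_ode`): the maximal operators are onto, and their eigenspaces are
two-dimensional for every complex parameter.

Lagrange's identity shows that a maximal operator and the minimal operator with conjugate
coefficients are formally adjoint. It also gives the key range statement: a vector orthogonal to the
kernel of one maximal operator is attained by the opposite minimal operator, since orthogonality to
two independent solutions forces the data at `b` to vanish (`IsRegular.exists_minOpPlus_eq`).

The rest is abstract (`LinearPMap.adjoint_eq_of_minimal_maximal`): surjectivity, the range statement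
and finite-dimensional kernels yield density and both adjoints. Closedness follows, because each of
the four operators is an adjoint. -/

/-! ### Absolutely continuous functions and primitives. -/

section AbsolutelyContinuous

variable {E : Type*} [NormedAddCommGroup E] {a b : ℝ}

namespace AbsolutelyContinuousOnInterval

/-- Transfers absolute continuity between different target spaces by comparing increments. -/
lemma of_dist_le {X Y : Type*} [PseudoMetricSpace X] [PseudoMetricSpace Y] {f : ℝ → X}
    {g : ℝ → Y} (hg : AbsolutelyContinuousOnInterval g a b)
    (K : ℝ) (h : ∀ x ∈ uIcc a b, ∀ y ∈ uIcc a b, dist (f x) (f y) ≤ K * dist (g x) (g y)) :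
    AbsolutelyContinuousOnInterval f a b := by
  have h0 := Filter.Tendsto.const_mul K hg
  rw [mul_zero] at h0
  refine squeeze_zero' (Filter.Eventually.of_forall fun E => Finset.sum_nonneg fun i _ =>
    dist_nonneg) ?_ h0
  refine Filter.eventually_inf_principal.2 (Filter.Eventually.of_forall fun E hE => ?_)
  rw [Finset.mul_sum]
  exact Finset.sum_le_sum fun i hi => h _ (hE.1 i hi).1 _ (hE.1 i hi).2

lemma comp_lipschitzOnWith {X Y : Type*} [PseudoMetricSpace X] [PseudoMetricSpace Y] {f : ℝ → X}
    (hf : AbsolutelyContinuousOnInterval f a b) {φ : X → Y} {K : NNReal} {s : Set X}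
    (hφ : LipschitzOnWith K φ s) (hs : ∀ x ∈ uIcc a b, f x ∈ s) :
    AbsolutelyContinuousOnInterval (fun x => φ (f x)) a b :=
  hf.of_dist_le K fun x hx y hy => hφ.dist_le_mul _ (hs x hx) _ (hs y hy)

lemma integral [NormedSpace ℝ E] {f : ℝ → E} (hf : IntervalIntegrable f volume a b) :
    AbsolutelyContinuousOnInterval (fun x => ∫ t in a..x, f t) a b := by
  have hn := hf.norm
  -- Increments are dominated by those of the real-valued primitive of `‖f‖`.
  refine (hn.absolutelyContinuousOnInterval_intervalIntegral left_mem_uIcc).of_dist_le 1 ?_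
  intro x hx y hy
  have i1 {x : ℝ} (hx : x ∈ uIcc a b) : IntervalIntegrable f volume a x :=
    hf.mono_set (uIcc_subset_uIcc left_mem_uIcc hx)
  rw [dist_eq_norm, Real.dist_eq, intervalIntegral.integral_interval_sub_left (i1 hx) (i1 hy),
    intervalIntegral.integral_interval_sub_left (i1 hx).norm (i1 hy).norm, one_mul]
  exact intervalIntegral.norm_integral_le_abs_integral_norm

lemma const (c : E) : AbsolutelyContinuousOnInterval (fun _ : ℝ => c) a b :=
  (LipschitzWith.const c).lipschitzOnWith.absolutelyContinuousOnInterval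

/-- The fundamental theorem of calculus for Banach-valued absolutely continuous functions. -/
lemma sub_eq_integral [NormedSpace ℝ E] [CompleteSpace E] {f g : ℝ → E} (hab : a ≤ b)
    (hf : AbsolutelyContinuousOnInterval f a b) (hg : IntegrableOn g (Ioo a b))
    (h : ∀ᵐ t ∂(volume.restrict (Ioo a b)), HasDerivAt f (g t) t) {x : ℝ} (hx : x ∈ Icc a b) :
    f x - f a = ∫ t in a..x, g t := by
  have hg' : IntervalIntegrable g volume a b :=
    (intervalIntegrable_iff_integrableOn_Ioo_of_le hab).2 hg
  have hI := hf.sub (integral hg')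
  rw [ae_restrict_congr_set Ioo_ae_eq_Icc, ae_restrict_iff' measurableSet_Icc] at h
  -- `f` minus the primitive of `g` is absolutely continuous with derivative zero a.e., hence
  -- constant.
  obtain ⟨C, hC⟩ := hI.const_of_ae_hasDerivAt_zero (by
    filter_upwards [h, hg'.ae_hasDerivAt_integral] with t h1 h2 ht
    have := (h1 (by rwa [uIcc_of_le hab] at ht)).sub (h2 ht a left_mem_uIcc)
    rwa [sub_self] at this)
  have h1 := hC x (by rwa [uIcc_of_le hab])
  have h2 := hC a left_mem_uIcc
  simp only [Pi.sub_apply, intervalIntegral.integral_same, sub_zero] at h1 h2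
  rw [h2, ← h1]
  abel

end AbsolutelyContinuousOnInterval

lemma ae_hasDerivAt_integral_Ioo [NormedSpace ℝ E] [CompleteSpace E] {g : ℝ → E} (hab : a ≤ b)
    (hg : IntegrableOn g (Ioo a b)) :
    ∀ᵐ t ∂(volume.restrict (Ioo a b)), HasDerivAt (fun x => ∫ s in a..x, g s) (g t) t := by
  have hg' : IntervalIntegrable g volume a b :=
    (intervalIntegrable_iff_integrableOn_Ioo_of_le hab).2 hg
  rw [ae_restrict_iff' measurableSet_Ioo]
  filter_upwards [hg'.ae_hasDerivAt_integral] with t h2 ht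
  exact h2 (by rw [uIcc_of_le hab]; exact Ioo_subset_Icc_self ht) a left_mem_uIcc

/-- `2 ∫ₐᵗ k exp(2m) ≤ exp(2m(t))` where `m` is the primitive of `k` vanishing at `a`. -/
lemma integral_mul_exp_primitive_le {k : ℝ → ℝ} (hab : a ≤ b) (hk : IntegrableOn k (Ioo a b))
    {x : ℝ} (hx : x ∈ Icc a b) :
    IntervalIntegrable (fun t => k t * Real.exp (2 * ∫ s in a..t, k s)) volume a x ∧
    ∫ t in a..x, k t * Real.exp (2 * ∫ s in a..t, k s) ≤
      Real.exp (2 * ∫ s in a..x, k s) / 2 := by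
  have hk' : IntervalIntegrable k volume a b :=
    (intervalIntegrable_iff_integrableOn_Ioo_of_le hab).2 hk
  have hm := AbsolutelyContinuousOnInterval.integral hk'
  have hm2 := hm.const_mul 2
  obtain ⟨C, hC⟩ := hm2.exists_bound
  -- The exponential is Lipschitz only on bounded sets, so the bound `C` on `2m` is needed before
  -- composing.
  obtain ⟨K, hK⟩ := ContDiffOn.exists_lipschitzOnWith (n := 1)
    (Real.contDiff_exp.contDiffOn (s := Icc (-C) C)) one_ne_zero (convex_Icc _ _) isCompact_Icc
  have he := hm2.comp_lipschitzOnWith hK fun x hx => abs_le.1 (hC x hx)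
  have hint : IntervalIntegrable (fun t => k t * Real.exp (2 * ∫ s in a..t, k s)) volume a b :=
    hk'.mul_continuousOn he.continuousOn
  have hd := he.sub_eq_integral hab
    (g := fun t => 2 * (k t * Real.exp (2 * ∫ s in a..t, k s)))
    (((intervalIntegrable_iff_integrableOn_Ioo_of_le hab).1 hint).const_mul 2) (by
      filter_upwards [ae_hasDerivAt_integral_Ioo hab hk] with t ht
      exact (ht.const_mul 2).exp.congr_deriv (by ring)) hx
  rw [intervalIntegral.integral_const_mul, intervalIntegral.integral_same, mul_zero,
    Real.exp_zero] at hd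
  refine ⟨hint.mono_set (uIcc_subset_uIcc left_mem_uIcc (by rwa [uIcc_of_le hab])), ?_⟩
  linarith

end AbsolutelyContinuous

/-! ### Linear systems with integrable coefficients. -/

section LinearODE

variable {E : Type*} [NormedAddCommGroup E] [NormedSpace ℝ E] {a b : ℝ}
  {A : ℝ → E →L[ℝ] E}

lemma integrableOn_clm_apply_continuous (hA : IntegrableOn A (Ioo a b)) {W : ℝ → E}
    (hW : ContinuousOn W (Icc a b)) : IntegrableOn (fun t => A t (W t)) (Ioo a b) := by
  obtain ⟨C, hC⟩ := isCompact_Icc.exists_bound_of_continuousOn hW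
  have hWm : AEStronglyMeasurable W (volume.restrict (Ioo a b)) :=
    (hW.mono Ioo_subset_Icc_self).aestronglyMeasurable measurableSet_Ioo
  refine (hA.norm.mul_const C).mono'
    ((ContinuousLinearMap.id ℝ (E →L[ℝ] E)).aestronglyMeasurable_comp₂
      hA.aestronglyMeasurable hWm) ?_
  filter_upwards [ae_restrict_mem measurableSet_Ioo] with t ht
  exact (A t).le_of_opNorm_le_of_le le_rfl (hC t (Ioo_subset_Icc_self ht))

/-- If `‖W‖ ≤ M exp(2m)` with `m` the primitive of `‖A‖`, then the primitive of `A W` is bounded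
by `M exp(2m) / 2`. -/
lemma norm_integral_clm_apply_le (hab : a ≤ b) (hA : IntegrableOn A (Ioo a b)) {W : ℝ → E} {M : ℝ}
    (hM : 0 ≤ M) (hW : ∀ t ∈ Icc a b, ‖W t‖ ≤ M * Real.exp (2 * ∫ s in a..t, ‖A s‖)) {x : ℝ}
    (hx : x ∈ Icc a b) :
    ‖∫ t in a..x, A t (W t)‖ ≤ M / 2 * Real.exp (2 * ∫ s in a..x, ‖A s‖) := by
  obtain ⟨h1, h2⟩ := integral_mul_exp_primitive_le hab hA.norm hx
  calc ‖∫ t in a..x, A t (W t)‖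
      ≤ ∫ t in a..x, M * (‖A t‖ * Real.exp (2 * ∫ s in a..t, ‖A s‖)) := by
        refine intervalIntegral.norm_integral_le_of_norm_le hx.1
          (Filter.Eventually.of_forall fun t ht => ?_) (h1.const_mul M)
        have := (A t).le_of_opNorm_le_of_le le_rfl (hW t ⟨ht.1.le, ht.2.trans hx.2⟩)
        linarith
    _ ≤ M / 2 * Real.exp (2 * ∫ s in a..x, ‖A s‖) := by
        rw [intervalIntegral.integral_const_mul]
        nlinarith

variable [CompleteSpace E]

/-- A linear Carathéodory initial value problem with integrable coefficients has an absolutely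
continuous solution. -/
theorem exists_absolutelyContinuous_solution (hab : a ≤ b) (hA : IntegrableOn A (Ioo a b))
    {F : ℝ → E} (hF : IntegrableOn F (Ioo a b)) (c : E) :
    ∃ Y : ℝ → E, AbsolutelyContinuousOnInterval Y a b ∧ Y a = c ∧
      ∀ᵐ t ∂(volume.restrict (Ioo a b)), HasDerivAt Y (A t (Y t) + F t) t := by
  set m : ℝ → ℝ := fun t => 2 * ∫ s in a..t, ‖A s‖ with hm
  have hmc : ContinuousOn m (Icc a b) := by
    have := (AbsolutelyContinuousOnInterval.integral
      ((intervalIntegrable_iff_integrableOn_Ioo_of_le hab).2 hA.norm)).continuousOn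
    rw [uIcc_of_le hab] at this
    exact this.const_mul 2
  -- The unknown is `Z = exp(-m) Y`. This Bielecki weight makes the Picard map a contraction with
  -- constant `1/2` on the whole interval, without subdividing it.
  let W : C(Icc a b, E) → ℝ → E := fun Z t => Real.exp (m t) • IccExtend hab Z t
  have hW (Z) : ContinuousOn (W Z) (Icc a b) :=
    (Real.continuous_exp.comp_continuousOn hmc).smul (Z.continuous.Icc_extend' (h := hab)).continuousOn
  have hG (Z) : IntegrableOn (fun t => A t (W Z t) + F t) (Ioo a b) :=
    (integrableOn_clm_apply_continuous hA (hW Z)).add hF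
  let Y : C(Icc a b, E) → ℝ → E := fun Z x => c + ∫ t in a..x, (A t (W Z t) + F t)
  have hYac (Z) : AbsolutelyContinuousOnInterval (Y Z) a b :=
    (AbsolutelyContinuousOnInterval.const c).add (AbsolutelyContinuousOnInterval.integral
      ((intervalIntegrable_iff_integrableOn_Ioo_of_le hab).2 (hG Z)))
  have hSc (Z) : ContinuousOn (fun x => Real.exp (-m x) • Y Z x) (Icc a b) := by
    have := (hYac Z).continuousOn
    rw [uIcc_of_le hab] at this
    exact (Real.continuous_exp.comp_continuousOn hmc.neg).smul this
  let S : C(Icc a b, E) → C(Icc a b, E) := fun Z =>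
    ⟨(Icc a b).domRestrict (fun x => Real.exp (-m x) • Y Z x), (hSc Z).domRestrict⟩
  have hS : ContractingWith (1 / 2) S := by
    refine ⟨by norm_num, LipschitzWith.of_dist_le_mul fun Z Z' => ?_⟩
    rw [ContinuousMap.dist_le (by positivity)]
    rintro ⟨x, hx⟩
    have hi (Z) : IntervalIntegrable (fun t => A t (W Z t) + F t) volume a x :=
      (((intervalIntegrable_iff_integrableOn_Ioo_of_le hab).2 (hG Z))).mono_set
        (uIcc_subset_uIcc left_mem_uIcc (by rwa [uIcc_of_le hab]))
    have e : Y Z x - Y Z' x = ∫ t in a..x, A t (W Z t - W Z' t) := by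
      simp only [Y, add_sub_add_left_eq_sub]
      rw [← intervalIntegral.integral_sub (hi Z) (hi Z')]
      simp
    have hb := norm_integral_clm_apply_le hab hA (W := fun t => W Z t - W Z' t)
      (M := dist Z Z') dist_nonneg (fun t ht => by
        simp only [W, ← smul_sub, norm_smul, Real.norm_eq_abs, Real.abs_exp]
        rw [mul_comm, IccExtend_of_mem hab _ ht, IccExtend_of_mem hab _ ht, ← dist_eq_norm]
        exact mul_le_mul_of_nonneg_right (ContinuousMap.dist_apply_le_dist _) (Real.exp_pos _).le)
      hx
    change dist (Real.exp (-m x) • Y Z x) (Real.exp (-m x) • Y Z' x) ≤ _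
    rw [dist_eq_norm, ← smul_sub, norm_smul, Real.norm_eq_abs, Real.abs_exp, e, Real.exp_neg,
      inv_mul_le_iff₀ (Real.exp_pos _)]
    refine hb.trans (le_of_eq ?_)
    simp only [hm]
    push_cast
    ring
  have hfix := hS.fixedPoint_isFixedPt
  set Z := hS.fixedPoint
  have hZ (x) (hx : x ∈ Icc a b) : W Z x = Y Z x := by
    have := congrArg (fun f : C(Icc a b, E) => f ⟨x, hx⟩) hfix
    change Real.exp (-m x) • Y Z x = Z ⟨x, hx⟩ at this
    simp only [W]
    rw [IccExtend_of_mem hab _ hx, ← this, smul_smul, ← Real.exp_add, add_neg_cancel,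
      Real.exp_zero, one_smul]
  refine ⟨Y Z, hYac Z, by simp [Y], ?_⟩
  filter_upwards [ae_hasDerivAt_integral_Ioo hab (hG Z), ae_restrict_mem measurableSet_Ioo]
    with t ht hmem
  rw [← hZ t (Ioo_subset_Icc_self hmem)]
  exact ht.const_add c

/-- Uniqueness for homogeneous linear Carathéodory problems. -/
theorem eqOn_zero_of_linear_ode (hab : a ≤ b) (hA : IntegrableOn A (Ioo a b)) {Y : ℝ → E}
    (hY : AbsolutelyContinuousOnInterval Y a b) (ha : Y a = 0)
    (h : ∀ᵐ t ∂(volume.restrict (Ioo a b)), HasDerivAt Y (A t (Y t)) t) :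
    EqOn Y 0 (Icc a b) := by
  have hYc := hY.continuousOn
  rw [uIcc_of_le hab] at hYc
  set m : ℝ → ℝ := fun t => 2 * ∫ s in a..t, ‖A s‖ with hm
  have hmc : ContinuousOn m (Icc a b) := by
    have := (AbsolutelyContinuousOnInterval.integral
      ((intervalIntegrable_iff_integrableOn_Ioo_of_le hab).2 hA.norm)).continuousOn
    rw [uIcc_of_le hab] at this
    exact this.const_mul 2
  -- The integral equation at a maximum point of the weighted norm gives `M ≤ M / 2`.
  obtain ⟨x₀, hx₀, hmax⟩ := isCompact_Icc.exists_isMaxOn (nonempty_Icc.2 hab)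
    ((Real.continuous_exp.comp_continuousOn hmc.neg).mul hYc.norm)
  set M := Real.exp (-m x₀) * ‖Y x₀‖ with hM
  have hM0 : 0 ≤ M := by positivity
  have hle (t) (ht : t ∈ Icc a b) : ‖Y t‖ ≤ M * Real.exp (m t) := by
    have : Real.exp (-m t) * ‖Y t‖ ≤ M := hmax ht
    rwa [Real.exp_neg, inv_mul_le_iff₀ (Real.exp_pos _), mul_comm] at this
  have hb := norm_integral_clm_apply_le hab hA hM0 hle hx₀
  rw [← hY.sub_eq_integral hab (integrableOn_clm_apply_continuous hA hYc) h hx₀, ha, sub_zero] at hb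
  have hMle : M ≤ M / 2 := by
    rw [hM, Real.exp_neg, inv_mul_le_iff₀ (Real.exp_pos _), ← Real.exp_neg, ← hM, mul_comm]
    exact hb
  have hM00 : M = 0 := by linarith
  intro t ht
  have := hle t ht
  rw [hM00, zero_mul] at this
  exact norm_le_zero_iff.1 this

end LinearODE

/-! ### The first-order system and Lagrange's identity. -/

namespace SturmLiouville

/-- The standing assumptions on the coefficients `p`, `Q`. -/
structure IsRegular (p Q : ℝ → ℂ) (a b : ℝ) : Prop where
  lt : a < b
  ne_zero : ∀ᵐ t ∂(μ a b), p t ≠ 0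
  inv : IntegrableOn (fun t => 1 / p t) (Ioo a b)
  div : IntegrableOn (fun t => Q t / p t) (Ioo a b)
  sq_div : IntegrableOn (fun t => Q t ^ 2 / p t) (Ioo a b)

variable {p Q : ℝ → ℂ} {a b : ℝ}

lemma integrableOn_conj {g : ℝ → ℂ} {s : Set ℝ} (hg : IntegrableOn g s) :
    IntegrableOn (fun t => conj (g t)) s :=
  (Complex.conjCLE.toContinuousLinearMap.integrable_comp hg :)

lemma IsRegular.conj (h : IsRegular p Q a b) :
    IsRegular (fun t => conj (p t)) (fun t => conj (Q t)) a b where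
  lt := h.lt
  ne_zero := by
    filter_upwards [h.ne_zero] with t ht
    simpa using ht
  inv := by simpa using integrableOn_conj h.inv
  div := by simpa using integrableOn_conj h.div
  sq_div := by simpa using integrableOn_conj h.sq_div

lemma memLp_of_continuousOn {y : ℝ → ℂ} (hy : ContinuousOn y (Icc a b)) :
    MemLp y 2 (μ a b) := by
  obtain ⟨C, hC⟩ := isCompact_Icc.exists_bound_of_continuousOn hy
  refine MemLp.of_bound ((hy.mono Ioo_subset_Icc_self).aestronglyMeasurable measurableSet_Ioo) C ?_
  filter_upwards [ae_restrict_mem measurableSet_Ioo] with t ht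
  exact hC t (Ioo_subset_Icc_self ht)

lemma memLp_of_ac {y : ℝ → ℂ} (hab : a < b) (hy : AbsolutelyContinuousOnInterval y a b) :
    MemLp y 2 (μ a b) :=
  memLp_of_continuousOn (by simpa [uIcc_of_le hab.le] using hy.continuousOn)

namespace IsRep

variable {f g : L2 a b} {y u z v : ℝ → ℂ}

lemma hasDerivAt_fst (H : IsRegular p Q a b) (h : IsRep p Q a b f y u) :
    ∀ᵐ t ∂(μ a b), HasDerivAt y (Q t / p t * y t + 1 / p t * u t) t := by
  filter_upwards [H.ne_zero, h.quasi_ae_eq, ae_differentiableAt h.ac] with t h1 h2 h3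
  refine h3.hasDerivAt.congr_deriv ?_
  rw [h2, quasiDeriv₁]
  field_simp
  ring

lemma hasDerivAt_snd (h : IsRep p Q a b f y u) :
    ∀ᵐ t ∂(μ a b),
      HasDerivAt u (quasiDeriv₂ p Q y u t - Q t / p t * u t - Q t ^ 2 / p t * y t) t := by
  filter_upwards [ae_differentiableAt h.quasi_ac] with t h3
  refine h3.hasDerivAt.congr_deriv ?_
  rw [quasiDeriv₂]
  ring

/-- Solutions of the first-order system represent elements of the maximal domain. -/
lemma of_hasDerivAt (H : IsRegular p Q a b) (hy : AbsolutelyContinuousOnInterval y a b)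
    (hu : AbsolutelyContinuousOnInterval u a b) {G : ℝ → ℂ} (hG : MemLp G 2 (μ a b))
    (h1 : ∀ᵐ t ∂(μ a b), HasDerivAt y (Q t / p t * y t + 1 / p t * u t) t)
    (h2 : ∀ᵐ t ∂(μ a b), HasDerivAt u (G t - Q t / p t * u t - Q t ^ 2 / p t * y t) t) :
    IsRep p Q a b ((memLp_of_ac H.lt hy).toLp y) y u ∧ quasiDeriv₂ p Q y u =ᵐ[μ a b] G := by
  have e : quasiDeriv₂ p Q y u =ᵐ[μ a b] G := by
    filter_upwards [h2] with t h2
    rw [quasiDeriv₂, h2.deriv]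
    ring
  refine ⟨⟨MemLp.coeFn_toLp _, hy, ?_, hu, hG.ae_eq e.symm⟩, e⟩
  filter_upwards [H.ne_zero, h1] with t h0 h1
  rw [quasiDeriv₁, h1.deriv]
  field_simp
  ring

/-- Lets the bilinear Lagrange identity be applied to the sesquilinear inner product. -/
lemma conjugate (hab : a < b) (h : IsRep p Q a b f y u) :
    (∃ f', IsRep (fun t => conj (p t)) (fun t => conj (Q t)) a b f' (fun t => conj (y t))
      (fun t => conj (u t))) ∧ quasiDeriv₂ (fun t => conj (p t)) (fun t => conj (Q t))
        (fun t => conj (y t)) (fun t => conj (u t)) = fun t => conj (quasiDeriv₂ p Q y u t) := by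
  have hac {y : ℝ → ℂ} (hy : AbsolutelyContinuousOnInterval y a b) :
      AbsolutelyContinuousOnInterval (fun t => conj (y t)) a b :=
    hy.of_dist_le 1 fun s _ t _ => by rw [Complex.dist_conj_conj, one_mul]
  have hd (y : ℝ → ℂ) (t : ℝ) : deriv (fun t => conj (y t)) t = conj (deriv y t) := deriv.star
  have e : quasiDeriv₂ (fun t => conj (p t)) (fun t => conj (Q t))
      (fun t => conj (y t)) (fun t => conj (u t)) = fun t => conj (quasiDeriv₂ p Q y u t) := by
    funext t
    simp [quasiDeriv₂, hd]
  refine ⟨⟨(memLp_of_ac hab (hac h.ac)).toLp _, MemLp.coeFn_toLp _, hac h.ac, ?_, hac h.quasi_ac,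
    ?_⟩, e⟩
  · filter_upwards [h.quasi_ae_eq] with t ht
    simp [quasiDeriv₁, hd, ht]
  · rw [e]
    exact h.memLp.star

/-- Lagrange's identity, bilinear form. -/
lemma integral_lagrange (H : IsRegular p Q a b) (h : IsRep p Q a b f y u)
    (h' : IsRep p Q a b g z v) :
    ∫ t, (quasiDeriv₂ p Q y u t * z t - y t * quasiDeriv₂ p Q z v t) ∂(μ a b) =
      (u b * z b - y b * v b) - (u a * z a - y a * v a) := by
  have hac : AbsolutelyContinuousOnInterval (u * z - y * v) a b :=
    (h.quasi_ac.smul h'.ac).sub (h.ac.smul h'.quasi_ac)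
  have hi : IntegrableOn (fun t => quasiDeriv₂ p Q y u t * z t - y t * quasiDeriv₂ p Q z v t)
      (Ioo a b) :=
    (h.memLp.integrable_mul (memLp_of_ac H.lt h'.ac)).sub
      ((memLp_of_ac H.lt h.ac).integrable_mul h'.memLp)
  have := hac.sub_eq_integral H.lt.le hi (by
    filter_upwards [h.hasDerivAt_fst H, h.hasDerivAt_snd, h'.hasDerivAt_fst H, h'.hasDerivAt_snd]
      with t h1 h2 h3 h4
    -- In `(u z - y v)'` all terms containing `Q/p`, `Q²/p` or `1/p` cancel.
    refine ((h2.mul h3).sub (h1.mul h4)).congr_deriv ?_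
    ring) (right_mem_Icc.2 H.lt.le)
  rw [intervalIntegral.integral_of_le H.lt.le, integral_Ioc_eq_integral_Ioo] at this
  exact this.symm

end IsRep

/-- The coefficient matrix of the first-order system equivalent to `-D^[2] y = c y`. -/
noncomputable def systemMatrix (p Q : ℝ → ℂ) (c : ℂ) (t : ℝ) : ℂ × ℂ →L[ℝ] ℂ × ℂ :=
  (Q t / p t) • (ContinuousLinearMap.inl ℝ ℂ ℂ ∘L ContinuousLinearMap.fst ℝ ℂ ℂ) +
  (1 / p t) • (ContinuousLinearMap.inl ℝ ℂ ℂ ∘L ContinuousLinearMap.snd ℝ ℂ ℂ) +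
  (-c - Q t ^ 2 / p t) • (ContinuousLinearMap.inr ℝ ℂ ℂ ∘L ContinuousLinearMap.fst ℝ ℂ ℂ) +
  (-(Q t / p t)) • (ContinuousLinearMap.inr ℝ ℂ ℂ ∘L ContinuousLinearMap.snd ℝ ℂ ℂ)

lemma systemMatrix_apply (c : ℂ) (t : ℝ) (x : ℂ × ℂ) : systemMatrix p Q c t x =
    (Q t / p t * x.1 + 1 / p t * x.2, -c * x.1 - Q t / p t * x.2 - Q t ^ 2 / p t * x.1) := by
  ext1
  · simp [systemMatrix]
  · simp [systemMatrix]
    ring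

lemma IsRegular.integrableOn_systemMatrix (H : IsRegular p Q a b) (c : ℂ) :
    IntegrableOn (systemMatrix p Q c) (Ioo a b) := by
  have h1 := H.div.smul_const (ContinuousLinearMap.inl ℝ ℂ ℂ ∘L ContinuousLinearMap.fst ℝ ℂ ℂ)
  have h2 := H.inv.smul_const (ContinuousLinearMap.inl ℝ ℂ ℂ ∘L ContinuousLinearMap.snd ℝ ℂ ℂ)
  have h3 := ((integrableOn_const (s := Ioo a b) (C := -c) (by simp)).sub H.sq_div).smul_const
    (ContinuousLinearMap.inr ℝ ℂ ℂ ∘L ContinuousLinearMap.fst ℝ ℂ ℂ)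
  have h4 := H.div.neg.smul_const
    (ContinuousLinearMap.inr ℝ ℂ ℂ ∘L ContinuousLinearMap.snd ℝ ℂ ℂ)
  exact ((h1.add h2).add h3).add h4

/-- The equation `-D^[2] y = c y + g` is solvable with prescribed data at `a`. -/
theorem IsRegular.exists_isRep (H : IsRegular p Q a b) (c : ℂ) {g : ℝ → ℂ}
    (hg : MemLp g 2 (μ a b)) (y₀ u₀ : ℂ) :
    ∃ f y u, IsRep p Q a b f y u ∧ y a = y₀ ∧ u a = u₀ ∧
      quasiDeriv₂ p Q y u =ᵐ[μ a b] fun t => -(c * y t + g t) := by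
  -- The interval has finite measure, so `L₂ ⊆ L₁`.
  have hg1 : IntegrableOn g (Ioo a b) := hg.integrable (by norm_num)
  obtain ⟨Y, hY, hYa, hd⟩ := exists_absolutelyContinuous_solution H.lt.le
    (H.integrableOn_systemMatrix c) (F := fun t => ((0 : ℂ), -g t))
    ((integrable_zero _ _ _).prodMk hg1.neg) (y₀, u₀)
  have hy : AbsolutelyContinuousOnInterval (fun t => (Y t).1) a b :=
    hY.comp_lipschitzOnWith (LipschitzWith.prod_fst.lipschitzOnWith (s := univ)) (by simp)
  have hu : AbsolutelyContinuousOnInterval (fun t => (Y t).2) a b :=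
    hY.comp_lipschitzOnWith (LipschitzWith.prod_snd.lipschitzOnWith (s := univ)) (by simp)
  obtain ⟨h1, h2⟩ := IsRep.of_hasDerivAt H hy hu (G := fun t => -(c * (Y t).1 + g t))
    (((memLp_of_ac H.lt hy).const_mul c).add hg).neg (by
      filter_upwards [hd] with t ht
      have := (hasFDerivAt_fst (𝕜 := ℝ) (p := Y t)).comp_hasDerivAt t ht
      refine HasDerivAt.congr_deriv (f := fun t => (Y t).1) this ?_
      simp [systemMatrix_apply]) (by
      filter_upwards [hd] with t ht
      have := (hasFDerivAt_snd (𝕜 := ℝ) (p := Y t)).comp_hasDerivAt t ht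
      refine HasDerivAt.congr_deriv (f := fun t => (Y t).2) this ?_
      simp [systemMatrix_apply]
      ring)
  exact ⟨_, _, _, h1, by simp [hYa], by simp [hYa], h2⟩

/-- A solution of `-D^[2] y = c y` with zero data at `a` vanishes. -/
theorem IsRep.eqOn_zero (H : IsRegular p Q a b) {c : ℂ} {f : L2 a b} {y u : ℝ → ℂ}
    (h : IsRep p Q a b f y u) (hya : y a = 0) (hua : u a = 0)
    (hc : quasiDeriv₂ p Q y u =ᵐ[μ a b] fun t => -(c * y t)) : EqOn y 0 (Icc a b) := by
  have hY : AbsolutelyContinuousOnInterval (fun t => (y t, u t)) a b := by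
    -- The pair is the sum of its two coordinate embeddings, each isometric.
    have h1 : AbsolutelyContinuousOnInterval (fun t => (y t, (0 : ℂ))) a b :=
      h.ac.of_dist_le 1 fun s _ t _ => by simp [Prod.dist_eq]
    have h2 : AbsolutelyContinuousOnInterval (fun t => ((0 : ℂ), u t)) a b :=
      h.quasi_ac.of_dist_le 1 fun s _ t _ => by simp [Prod.dist_eq]
    exact (h1.add h2).of_dist_le 1 fun s _ t _ => by simp
  have := eqOn_zero_of_linear_ode H.lt.le (H.integrableOn_systemMatrix c) hY
    (by simp [hya, hua]) (by
      filter_upwards [h.hasDerivAt_fst H, h.hasDerivAt_snd, hc] with t h1 h2 h3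
      rw [h3] at h2
      refine (h1.prodMk h2).congr_deriv ?_
      rw [systemMatrix_apply]
      simp)
  intro t ht
  exact congrArg Prod.fst (this ht)

end SturmLiouville

/-! ### Adjoints of a minimal and a maximal operator, abstractly. -/

namespace LinearPMap

variable {H : Type*} [NormedAddCommGroup H] [InnerProductSpace ℂ H] [CompleteSpace H]

/-- An abstract criterion identifying the adjoints of a minimal operator `T` and a maximal operator
`S` in terms of a formally adjoint pair `T'`, `S'`. -/
theorem adjoint_eq_of_minimal_maximal {S T S' T' : H →ₗ.[ℂ] H} (hTS : T ≤ S)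
    (hT : T.IsFormalAdjoint S') (hS : S.IsFormalAdjoint T')
    (surj : ∀ h, ∃ x : S.domain, S x = h) (surj' : ∀ h, ∃ x : S'.domain, S' x = h)
    (range_T' : ∀ h, (∀ x ∈ S.eigenspaceAt 0, inner ℂ x h = 0) → ∃ y : T'.domain, T' y = h)
    (range_T : ∀ h, (∀ x ∈ S'.eigenspaceAt 0, inner ℂ x h = 0) → ∃ y : T.domain, T y = h)
    (fin : FiniteDimensional ℂ (S'.eigenspaceAt 0)) :
    Dense (T.domain : Set H) ∧ T.adjoint = S' ∧ S.adjoint = T' := by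
  -- `(ran T)ᗮ ⊆ ker S'`: by `range_T`, `ran T` contains `(ker S')ᗮ`, and the finite-dimensional
  -- `ker S'` equals its double orthogonal complement.
  have key (z : H) (hz : ∀ y : T.domain, inner ℂ z (T y) = 0) : z ∈ S'.eigenspaceAt 0 := by
    rw [← Submodule.orthogonal_orthogonal (S'.eigenspaceAt 0), Submodule.mem_orthogonal]
    intro w hw
    obtain ⟨y, rfl⟩ := range_T w fun x hx => (Submodule.mem_orthogonal _ _).1 hw x hx
    exact inner_eq_zero_symm.1 (hz y)
  have hdense : Dense (T.domain : Set H) := by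
    rw [Submodule.dense_iff_topologicalClosure_eq_top, Submodule.topologicalClosure_eq_top_iff,
      Submodule.eq_bot_iff]
    intro h hh
    -- If `S' z` is orthogonal to `dom T`, then `z` is orthogonal to `ran T`, so `S' z = 0`.
    obtain ⟨z, rfl⟩ := surj' h
    obtain ⟨hd, h0⟩ := key z fun y => by
      rw [← hT.symm z y]
      exact inner_eq_zero_symm.1 ((Submodule.mem_orthogonal _ _).1 hh y y.2)
    rw [zero_smul] at h0
    exact h0
  have hdenseS : Dense (S.domain : Set H) := hdense.mono hTS.1
  refine ⟨hdense, ?_, ?_⟩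
  · refine (eq_of_le_of_domain_eq (hT.le_adjoint hdense) ?_).symm
    refine le_antisymm (hT.le_adjoint hdense).1 fun z hz => ?_
    -- `z - z₀` is orthogonal to `ran T`, so `z` differs from `z₀` by an element of `ker S'`.
    obtain ⟨z₀, hz₀⟩ := surj' (T.adjoint ⟨z, hz⟩)
    obtain ⟨hd, -⟩ := key (z - z₀) fun y => by
      rw [inner_sub_left, ← hT.symm z₀ y, hz₀, ← adjoint_isFormalAdjoint hdense ⟨z, hz⟩ y, sub_self]
    simpa using S'.domain.add_mem hd z₀.2
  · refine (eq_of_le_of_domain_eq (hS.le_adjoint hdenseS) ?_).symm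
    refine le_antisymm (hS.le_adjoint hdenseS).1 fun z hz => ?_
    have hz' := adjoint_isFormalAdjoint hdenseS ⟨z, hz⟩
    -- `S* z` is orthogonal to `ker S`, hence equals some `T' z₀`; then `z - z₀` is orthogonal to
    -- `ran S`, which is all of `H`.
    obtain ⟨z₀, hz₀⟩ := range_T' (S.adjoint ⟨z, hz⟩) fun x hx => by
      obtain ⟨hxd, hx0⟩ := hx
      rw [inner_eq_zero_symm, hz' ⟨x, hxd⟩, hx0, zero_smul, inner_zero_right]
    have : z - z₀ = 0 := by
      obtain ⟨y, hy⟩ := surj (z - z₀)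
      rw [← inner_self_eq_zero (𝕜 := ℂ)]
      nth_rw 2 [← hy]
      rw [inner_sub_left, ← hz' y, ← hS.symm z₀ y, hz₀, sub_self]
    rw [sub_eq_zero.1 this]
    exact z₀.2

end LinearPMap

/-! ### Eigenspaces, Green's formula and ranges. -/

namespace SturmLiouville

variable {p Q : ℝ → ℂ} {a b : ℝ}

lemma maxOp_apply_ae {f : L2 a b} (hf : f ∈ (maxOp p Q a b).domain) {y u : ℝ → ℂ}
    (h : IsRep p Q a b f y u) :
    (maxOp p Q a b ⟨f, hf⟩ : ℝ → ℂ) =ᵐ[μ a b] fun t => -quasiDeriv₂ p Q y u t := by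
  rw [maxOp_apply ⟨f, hf⟩ h]
  filter_upwards [Lp.coeFn_neg (h.memLp.toLp (quasiDeriv₂ p Q y u)), h.memLp.coeFn_toLp]
    with t h1 h2
  rw [h1, Pi.neg_apply, h2]

/-- An element of the maximal domain is an eigenvector iff its representative solves the
corresponding differential equation. -/
lemma mem_eigenspaceAt_iff {c : ℂ} {f : L2 a b} {y u : ℝ → ℂ} (h : IsRep p Q a b f y u) :
    f ∈ (maxOp p Q a b).eigenspaceAt c ↔
      quasiDeriv₂ p Q y u =ᵐ[μ a b] fun t => -(c * y t) := by
  have hf : f ∈ (maxOp p Q a b).domain := ⟨y, u, h⟩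
  have e : f ∈ (maxOp p Q a b).eigenspaceAt c ↔ maxOp p Q a b ⟨f, hf⟩ = c • f :=
    ⟨fun ⟨_, h⟩ => h, fun h => ⟨hf, h⟩⟩
  rw [e, Lp.ext_iff]
  have h1 := maxOp_apply_ae hf h
  have h2 := Lp.coeFn_smul c f
  constructor
  · intro h3
    filter_upwards [h1, h2, h3, h.ae_eq] with t h1 h2 h3 h4
    rw [h1, h2, Pi.smul_apply, h4, smul_eq_mul] at h3
    rw [← h3, neg_neg]
  · intro h3
    filter_upwards [h1, h2, h3, h.ae_eq] with t h1 h2 h3 h4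
    rw [h1, h2, Pi.smul_apply, h4, smul_eq_mul, h3, neg_neg]

lemma IsRep.eq_zero {f : L2 a b} {y u : ℝ → ℂ} (h : IsRep p Q a b f y u)
    (hy : EqOn y 0 (Icc a b)) : f = 0 := by
  rw [Lp.eq_zero_iff_ae_eq_zero]
  filter_upwards [h.ae_eq, ae_restrict_mem measurableSet_Ioo] with t h1 h2
  rw [h1, hy (Ioo_subset_Icc_self h2)]

/-- A representative of `0` vanishes at `a` together with its quasi-derivative. -/
lemma IsRep.left_eq_zero (hab : a < b) {y u : ℝ → ℂ} (h : IsRep p Q a b 0 y u) :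
    y a = 0 ∧ u a = 0 := by
  have aux {w : ℝ → ℂ} (hw : AbsolutelyContinuousOnInterval w a b) (h0 : w =ᵐ[μ a b] 0) :
      w a = 0 := by
    have h1 := eqOn_of_ae_eq hw (AbsolutelyContinuousOnInterval.const 0) h0
    have hc := hw.continuousOn
    rw [uIcc_of_le hab.le, ← closure_Ioo hab.ne] at hc
    have := h1.of_subset_closure (s := Ioo a b) (t := closure (Ioo a b)) hc continuousOn_const
      subset_closure le_rfl
    exact this (by rw [closure_Ioo hab.ne]; exact left_mem_Icc.2 hab.le)
  have hy0 : y =ᵐ[μ a b] 0 := h.ae_eq.symm.trans (Lp.coeFn_zero _ _ _)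
  refine ⟨aux h.ac hy0, aux h.quasi_ac ?_⟩
  have he := eqOn_of_ae_eq h.ac (AbsolutelyContinuousOnInterval.const (0 : ℂ)) hy0
  filter_upwards [h.quasi_ae_eq, hy0, deriv_ae_eq he] with t h1 h2 h3
  rw [h1, quasiDeriv₁, h2, h3]
  simp

/-- The solutions of `-D^[2] y = c y` with data `(1, 0)` and `(0, 1)` at `a` are a basis of the
eigenspace. -/
theorem IsRegular.exists_basis (H : IsRegular p Q a b) (c : ℂ) :
    Nonempty (Module.Basis (Fin 2) ℂ ((maxOp p Q a b).eigenspaceAt c)) := by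
  obtain ⟨f₁, y₁, u₁, h₁, hy₁, hu₁, hc₁⟩ := H.exists_isRep c (g := 0) MemLp.zero 1 0
  obtain ⟨f₂, y₂, u₂, h₂, hy₂, hu₂, hc₂⟩ := H.exists_isRep c (g := 0) MemLp.zero 0 1
  have m₁ := (mem_eigenspaceAt_iff h₁ (c := c)).2 (by simpa using hc₁)
  have m₂ := (mem_eigenspaceAt_iff h₂ (c := c)).2 (by simpa using hc₂)
  refine ⟨Module.Basis.mk (v := ![⟨f₁, m₁⟩, ⟨f₂, m₂⟩]) ?_ ?_⟩
  · rw [LinearIndependent.pair_iff]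
    intro s t hst
    have h0 : s • f₁ + t • f₂ = 0 := congrArg Subtype.val hst
    have hr := (h₁.smul s).add (h₂.smul t)
    rw [h0] at hr
    simpa [hy₁, hu₁, hy₂, hu₂] using hr.left_eq_zero H.lt
  · rintro ⟨f, hf⟩ -
    obtain ⟨y, u, h⟩ := hf.1
    rw [Matrix.range_cons, Matrix.range_cons, Matrix.range_empty, union_empty, singleton_union,
      Submodule.mem_span_pair]
    refine ⟨y a, u a, Subtype.ext ?_⟩
    -- The difference from the combination with the same data at `a` solves the equation with zero
    -- data.
    have hr := h.add (((h₁.smul (y a)).add (h₂.smul (u a))).smul (-1))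
    have hm := ((maxOp p Q a b).eigenspaceAt c).add_mem hf (Submodule.smul_mem _ (-1 : ℂ)
      (Submodule.add_mem _ (Submodule.smul_mem _ (y a) m₁) (Submodule.smul_mem _ (u a) m₂)))
    have h0 := hr.eq_zero (hr.eqOn_zero H (by simp [hy₁, hy₂]) (by simp [hu₁, hu₂])
      ((mem_eigenspaceAt_iff hr).1 hm))
    rw [neg_one_smul, ← sub_eq_add_neg, sub_eq_zero] at h0
    exact h0.symm

/-- Green's formula. -/
lemma inner_maxOpPlus_sub (H : IsRegular p Q a b) {f g : L2 a b} {y u z v : ℝ → ℂ}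
    (h : IsRep p Q a b f y u)
    (h' : IsRep (fun t => conj (p t)) (fun t => conj (Q t)) a b g z v) :
    inner ℂ (maxOp (fun t => conj (p t)) (fun t => conj (Q t)) a b ⟨g, z, v, h'⟩) f -
      inner ℂ g (maxOp p Q a b ⟨f, y, u, h⟩) =
      (u b * conj (z b) - y b * conj (v b)) - (u a * conj (z a) - y a * conj (v a)) := by
  obtain ⟨⟨g', hg'⟩, e⟩ := h'.conjugate H.lt
  simp only [Complex.conj_conj] at hg' e
  have hL := h.integral_lagrange H hg'
  rw [← hL, L2.inner_def, L2.inner_def, ← integral_sub (L2.integrable_inner _ _)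
    (L2.integrable_inner _ _)]
  refine integral_congr_ae ?_
  filter_upwards [h.ae_eq, h'.ae_eq, maxOp_apply_ae ⟨y, u, h⟩ h, maxOp_apply_ae ⟨z, v, h'⟩ h']
    with t h1 h2 h3 h4
  rw [h1, h2, h3, h4, e]
  simp
  ring

/-- Imposing zero data at `a` leaves only the data at `b` as an obstruction to lying in the minimal
domain. -/
lemma IsRegular.maxOp_surjective (H : IsRegular p Q a b) (h : L2 a b) :
    ∃ f y u, ∃ hf : IsRep p Q a b f y u, y a = 0 ∧ u a = 0 ∧
      maxOp p Q a b ⟨f, y, u, hf⟩ = h := by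
  obtain ⟨f, y, u, hf, hy, hu, e⟩ := H.exists_isRep 0 (Lp.memLp h) 0 0
  refine ⟨f, y, u, hf, hy, hu, Lp.ext ?_⟩
  filter_upwards [maxOp_apply_ae ⟨y, u, hf⟩ hf, e] with t h1 h2
  rw [h1, h2]
  simp

lemma minOp_le_maxOp : minOp p Q a b ≤ maxOp p Q a b :=
  LinearPMap.domRestrict_le

lemma IsRegular.maxOp_isFormalAdjoint_minOpPlus (H : IsRegular p Q a b) :
    (maxOp p Q a b).IsFormalAdjoint (minOpPlus p Q a b) := by
  refine LinearPMap.IsFormalAdjoint.symm ?_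
  rintro ⟨g, hg⟩ ⟨f, y, u, h⟩
  have hg' := hg
  rw [minOpPlus, minOp_domain] at hg'
  obtain ⟨z, v, h', h1, h2, h3, h4⟩ := hg'
  have := inner_maxOpPlus_sub H h h'
  rw [h1, h2, h3, h4] at this
  simp only [map_zero, mul_zero, sub_zero, sub_eq_zero] at this
  refine Eq.trans ?_ this
  congr 1

/-- Vectors orthogonal to the kernel of `L_max` are in the range of `L_min⁺`. -/
lemma IsRegular.exists_minOpPlus_eq (H : IsRegular p Q a b) (h : L2 a b)
    (hh : ∀ x ∈ (maxOp p Q a b).eigenspaceAt 0, inner ℂ x h = 0) :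
    ∃ g : (minOpPlus p Q a b).domain, minOpPlus p Q a b g = h := by
  obtain ⟨g, z, v, hg, hz, hv, rfl⟩ := H.conj.maxOp_surjective h
  obtain ⟨f₁, y₁, u₁, h₁, hy₁, hu₁, hc₁⟩ := H.exists_isRep 0 (g := 0) MemLp.zero 1 0
  obtain ⟨f₂, y₂, u₂, h₂, hy₂, hu₂, hc₂⟩ := H.exists_isRep 0 (g := 0) MemLp.zero 0 1
  simp only [zero_mul, Pi.zero_apply, add_zero, neg_zero] at hc₁ hc₂
  -- For a kernel element both inner products in Green's formula vanish, as do the terms at `a`.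
  have bdry {f y u} (hf : IsRep p Q a b f y u) (hc : quasiDeriv₂ p Q y u =ᵐ[μ a b] fun _ => 0) :
      u b * conj (z b) - y b * conj (v b) = 0 := by
    have hm := (mem_eigenspaceAt_iff hf (c := 0)).2 (by simpa using hc)
    have h1 := inner_maxOpPlus_sub H hf hg
    obtain ⟨hd, he⟩ := hm
    rw [he, zero_smul, inner_zero_right, hz, hv, inner_eq_zero_symm.1 (hh f ⟨hd, he⟩)] at h1
    simpa using h1.symm
  have e₁ := bdry h₁ hc₁
  have e₂ := bdry h₂ hc₂
  -- The Wronskian-type expression is constant by Lagrange's identity; its value at `a` is `0 * 0 -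
  -- 1 * 1`.
  have hW : u₁ b * y₂ b - y₁ b * u₂ b = -1 := by
    have hL := h₁.integral_lagrange H h₂
    rw [integral_congr_ae (g := fun _ => 0) (by
      filter_upwards [hc₁, hc₂] with t h1 h2
      rw [h1, h2]
      simp), integral_zero, hy₁, hy₂, hu₁, hu₂] at hL
    linear_combination -hL
  -- Cramer's rule for `e₁`, `e₂`, with determinant given by `hW`.
  have hzb : z b = 0 := by
    rw [← Complex.conj_conj (z b), map_eq_zero]
    linear_combination conj (z b) * hW - y₂ b * e₁ + y₁ b * e₂
  have hvb : v b = 0 := by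
    rw [← Complex.conj_conj (v b), map_eq_zero]
    linear_combination conj (v b) * hW - u₂ b * e₁ + u₁ b * e₂
  have hmem : g ∈ (minOpPlus p Q a b).domain := by
    rw [minOpPlus, minOp_domain]
    exact ⟨z, v, hg, hz, hv, hzb, hvb⟩
  exact ⟨⟨g, hmem⟩, minOp_le_maxOp.2 rfl⟩

end SturmLiouville

/-! ### Adjoints of the differential operators and a.e. real coefficients. -/

namespace SturmLiouville

variable {p Q : ℝ → ℂ} {a b : ℝ}

lemma maxOpPlus_conj :
    maxOpPlus (fun t => conj (p t)) (fun t => conj (Q t)) a b = maxOp p Q a b := by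
  simp only [maxOpPlus, Complex.conj_conj]

lemma minOpPlus_conj :
    minOpPlus (fun t => conj (p t)) (fun t => conj (Q t)) a b = minOp p Q a b := by
  simp only [minOpPlus, Complex.conj_conj]

theorem IsRegular.adjoint_eq (H : IsRegular p Q a b) :
    Dense ((minOp p Q a b).domain : Set (L2 a b)) ∧
      (minOp p Q a b).adjoint = maxOpPlus p Q a b ∧
      (maxOp p Q a b).adjoint = minOpPlus p Q a b := by
  obtain ⟨B⟩ := H.conj.exists_basis 0
  have surj {p Q} (H : IsRegular p Q a b) (h : L2 a b) :
      ∃ x : (maxOp p Q a b).domain, maxOp p Q a b x = h := by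
    obtain ⟨f, y, u, hf, -, -, e⟩ := H.maxOp_surjective h
    exact ⟨_, e⟩
  -- Conjugating the coefficients twice returns the original operators, so the second half of the
  -- hypotheses comes from the first.
  have h1 := H.conj.maxOp_isFormalAdjoint_minOpPlus
  have h2 := H.conj.exists_minOpPlus_eq
  rw [minOpPlus_conj] at h1 h2
  exact LinearPMap.adjoint_eq_of_minimal_maximal minOp_le_maxOp h1.symm
    H.maxOp_isFormalAdjoint_minOpPlus (surj H) (surj H.conj) H.exists_minOpPlus_eq h2
    (Module.Finite.of_basis B)

lemma IsRep.congr_coeff {p' Q' : ℝ → ℂ} (hp : p =ᵐ[μ a b] p') (hQ : Q =ᵐ[μ a b] Q') {f : L2 a b}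
    {y u : ℝ → ℂ} (h : IsRep p Q a b f y u) :
    IsRep p' Q' a b f y u ∧ quasiDeriv₂ p Q y u =ᵐ[μ a b] quasiDeriv₂ p' Q' y u := by
  have e : quasiDeriv₂ p Q y u =ᵐ[μ a b] quasiDeriv₂ p' Q' y u := by
    filter_upwards [hp, hQ] with t h1 h2
    rw [quasiDeriv₂, quasiDeriv₂, h1, h2]
  refine ⟨⟨h.ae_eq, h.ac, ?_, h.quasi_ac, h.memLp.ae_eq e⟩, e⟩
  filter_upwards [hp, hQ, h.quasi_ae_eq] with t h1 h2 h3
  rw [h3, quasiDeriv₁, quasiDeriv₁, h1, h2]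

/-- The maximal and minimal operators depend only on the a.e. classes of the coefficients. -/
lemma maxOp_congr {p' Q' : ℝ → ℂ} (hp : p =ᵐ[μ a b] p') (hQ : Q =ᵐ[μ a b] Q') :
    maxOp p Q a b = maxOp p' Q' a b ∧ minOp p Q a b = minOp p' Q' a b := by
  have hmax : maxOp p Q a b = maxOp p' Q' a b := by
    refine LinearPMap.ext (Submodule.ext fun f => ⟨?_, ?_⟩) ?_
    · rintro ⟨y, u, h⟩
      exact ⟨y, u, (h.congr_coeff hp hQ).1⟩
    · rintro ⟨y, u, h⟩
      exact ⟨y, u, (h.congr_coeff hp.symm hQ.symm).1⟩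
    · rintro f ⟨y, u, h⟩ hf'
      have h' := h.congr_coeff hp hQ
      refine Lp.ext ?_
      filter_upwards [maxOp_apply_ae ⟨y, u, h⟩ h, maxOp_apply_ae hf' h'.1, h'.2] with t h1 h2 h3
      rw [h1, h2, h3]
  have hdom : minDomain p Q a b = minDomain p' Q' a b := by
    refine Submodule.ext fun f => ⟨?_, ?_⟩
    · rintro ⟨y, u, h, h'⟩
      exact ⟨y, u, (h.congr_coeff hp hQ).1, h'⟩
    · rintro ⟨y, u, h, h'⟩
      exact ⟨y, u, (h.congr_coeff hp.symm hQ.symm).1, h'⟩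
  exact ⟨hmax, by rw [minOp, minOp, hmax, hdom]⟩

end SturmLiouville

theorem mainTheorem5 (a b : ℝ) (hab : a < b) (p Q : ℝ → ℂ)
    (hp : ∀ᵐ t ∂(volume.restrict (Ioo a b)), p t ≠ 0)
    (h₀ : IntegrableOn (fun t => 1 / p t) (Ioo a b))
    (h₁ : IntegrableOn (fun t => Q t / p t) (Ioo a b))
    (h₂ : IntegrableOn (fun t => Q t ^ 2 / p t) (Ioo a b)) :
    ((SturmLiouville.minOp p Q a b).IsClosed ∧
      Dense ((SturmLiouville.minOp p Q a b).domain : Set (SturmLiouville.L2 a b))) ∧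
    ((SturmLiouville.minOpPlus p Q a b).IsClosed ∧
      Dense ((SturmLiouville.minOpPlus p Q a b).domain : Set (SturmLiouville.L2 a b))) ∧
    ((SturmLiouville.maxOp p Q a b).IsClosed ∧
      Dense ((SturmLiouville.maxOp p Q a b).domain : Set (SturmLiouville.L2 a b))) ∧
    ((SturmLiouville.maxOpPlus p Q a b).IsClosed ∧
      Dense ((SturmLiouville.maxOpPlus p Q a b).domain : Set (SturmLiouville.L2 a b))) ∧
    (SturmLiouville.minOp p Q a b).adjoint = SturmLiouville.maxOpPlus p Q a b ∧
    (SturmLiouville.maxOp p Q a b).adjoint = SturmLiouville.minOpPlus p Q a b ∧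
    ((∀ᵐ t ∂(volume.restrict (Ioo a b)), (p t).im = 0 ∧ (Q t).im = 0) →
      SturmLiouville.minOp p Q a b = SturmLiouville.minOpPlus p Q a b ∧
      (SturmLiouville.minOp p Q a b).IsSymmetricOp ∧
      (SturmLiouville.minOp p Q a b).deficiencyIndex = (2, 2) ∧
      (SturmLiouville.minOp p Q a b).adjoint = SturmLiouville.maxOp p Q a b ∧
      (SturmLiouville.maxOp p Q a b).adjoint = SturmLiouville.minOp p Q a b) := by

  have H : SturmLiouville.IsRegular p Q a b := ⟨hab, hp, h₀, h₁, h₂⟩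
  obtain ⟨d, e₁, e₂⟩ := H.adjoint_eq
  obtain ⟨d', e₁', e₂'⟩ := H.conj.adjoint_eq
  rw [SturmLiouville.maxOpPlus_conj] at e₁'
  rw [SturmLiouville.minOpPlus_conj] at e₂'
  have D := d.mono SturmLiouville.minOp_le_maxOp.1
  have D' := d'.mono SturmLiouville.minOp_le_maxOp.1
  refine ⟨⟨?_, d⟩, ⟨?_, d'⟩, ⟨?_, D⟩, ⟨?_, D'⟩, e₁, e₂, fun hreal => ?_⟩
  · rw [← e₂']
    exact LinearPMap.adjoint_isClosed D'
  · rw [← e₂]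
    exact LinearPMap.adjoint_isClosed D
  · rw [← e₁']
    exact LinearPMap.adjoint_isClosed d'
  · rw [← e₁]
    exact LinearPMap.adjoint_isClosed d
  obtain ⟨hmax, hmin⟩ := SturmLiouville.maxOp_congr (a := a) (b := b) (p := p) (Q := Q)
    (p' := fun t => conj (p t)) (Q' := fun t => conj (Q t))
    (hreal.mono fun t ht => (Complex.conj_eq_iff_im.2 ht.1).symm)
    (hreal.mono fun t ht => (Complex.conj_eq_iff_im.2 ht.2).symm)
  have e₃ : (SturmLiouville.minOp p Q a b).adjoint = SturmLiouville.maxOp p Q a b :=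
    e₁.trans hmax.symm
  have e₄ : (SturmLiouville.maxOp p Q a b).adjoint = SturmLiouville.minOp p Q a b :=
    e₂.trans hmin.symm
  refine ⟨hmin, ⟨d, ?_⟩, ?_, e₃, e₄⟩
  · intro x y
    have h := LinearPMap.adjoint_isFormalAdjoint d
    -- Symmetry holds because the minimal operator is a restriction of its adjoint, the maximal one.
    rw [e₃] at h
    rw [← h ⟨x, SturmLiouville.minOp_le_maxOp.1 x.2⟩ y]
    congr 1
  · have hr (c : ℂ) : Module.rank ℂ ((SturmLiouville.maxOp p Q a b).eigenspaceAt c) = 2 := by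
      obtain ⟨B⟩ := H.exists_basis c
      rw [rank_eq_card_basis B]
      simp
    rw [LinearPMap.deficiencyIndex, e₃, hr, hr]
    simp
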